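/- Let $G=(V,E)$ be a finite connected simple undirected graph with edge weights $w(e)\ge 0$, $e\in E$, and suppose that the edges of positive weight already connect $V$ (this is automatic if all weights are positive). Put $w(\{i,j\})=0$ if $\{i,j\}\notin E$, and let $L\in\mathbb{R}^{V\times V}$ be the Laplacian, $L_{ij}=-w(\{i,j\})$ for $i\ne j$ and $L_{ii}=\sum_{k\neq i} w(\{i,k\})$. The weight of a graph is the product of the weights of its edges (equal to $1$ if there are none), and the weight of a set of graphs is the sum of the weights of its members. Let $\mathcal T$ be the set of spanning trees of $G$ and, for $u,v\in V$, let $\mathcal F_u^v$ be the set of spanning forests of $G$ that consist of exactly two trees and in which $u$ and $v$ are not connected. Let $u,v\in V$ be arbitrary. (a) If $\ell^+_{ij}$ denotes the entries of the Moore--Penrose pseudo-inverse $L^+$ of $L$, then \[ w(\mathcal F_u^v)=w(\mathcal T)\left(\ell^+_{uu}+\ell^+_{vv}-2\ell^+_{uv}\right). \] (b) For $r\in V$ let $L^{[r]}$ be the matrix obtained from $L$ by removing the row and the column of $r$. Then $L^{[r]}$ is invertible for every $r\in V$, and, with $\ell^{-1,[r]}_{ij}$ denoting the entries of its inverse, \[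 w(\mathcal F_u^v)=\begin{cases} w(\mathcal T)\left(\ell^{-1,[r]}_{uu}+\ell^{-1,[r]}_{vv}-2\ell^{-1,[r]}_{uv}\right) & \text{if } r\ne u,v,\\ w(\mathcal T)\,\ell^{-1,[v]}_{uu} & \text{if } r=v \text{ and } u\ne v,\\ w(\mathcal T)\,\ell^{-1,[u]}_{vv} & \text{if } r=u \text{ and } u\neq v.\end{cases} \] -/

import Mathlib

namespace WeightedGraph

open Matrix

/-! ### Moore–Penrose pseudo-inverse of a real matrix -/

/-- `X` satisfies the four Penrose equations for `A`. -/
structure IsPseudoInverse {m n : Type*} [Fintype m] [Fintype n]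
    (A : Matrix m n ℝ) (X : Matrix n m ℝ) : Prop where
  mul_mul_self : A * X * A = A
  mul_mul_inv : X * A * X = X
  symm_left : (A * X)ᵀ = A * X
  symm_right : (X * A)ᵀ = X * A

/-- The Penrose equations have at most one solution. -/
theorem IsPseudoInverse.unique {m n : Type*} [Fintype m] [Fintype n]
    {A : Matrix m n ℝ} {X Y : Matrix n m ℝ}
    (hX : IsPseudoInverse A X) (hY : IsPseudoInverse A Y) : X = Y := by
  have h1 : A * X = A * Y := by
    calc A * X = (A * X)ᵀ := hX.symm_left.symm
      _ = ((A * Y) * (A * X))ᵀ := by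
          rw [← Matrix.mul_assoc (A * Y), hY.mul_mul_self]
      _ = (A * X)ᵀ * (A * Y)ᵀ := Matrix.transpose_mul _ _
      _ = (A * X) * (A * Y) := by rw [hX.symm_left, hY.symm_left]
      _ = A * Y := by rw [← Matrix.mul_assoc, hX.mul_mul_self]
  have h2 : X * A = Y * A := by
    calc X * A = (X * A)ᵀ := hX.symm_right.symm
      _ = ((X * A) * (Y * A))ᵀ := by
          rw [Matrix.mul_assoc X, ← Matrix.mul_assoc A, hY.mul_mul_self]
      _ = (Y * A)ᵀ * (X * A)ᵀ := Matrix.transpose_mul _ _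
      _ = (Y * A) * (X * A) := by rw [hX.symm_right, hY.symm_right]
      _ = Y * A := by rw [Matrix.mul_assoc Y, ← Matrix.mul_assoc A, hX.mul_mul_self]
  calc X = X * A * X := hX.mul_mul_inv.symm
    _ = Y * A * X := by rw [h2]
    _ = Y * (A * X) := Matrix.mul_assoc _ _ _
    _ = Y * (A * Y) := by rw [h1]
    _ = Y * A * Y := (Matrix.mul_assoc _ _ _).symm
    _ = Y := hY.mul_mul_inv

/-- Transposition commutes with taking pseudo-inverses. -/
theorem IsPseudoInverse.transpose {m n : Type*} [Fintype m] [Fintype n]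
    {A : Matrix m n ℝ} {X : Matrix n m ℝ} (h : IsPseudoInverse A X) :
    IsPseudoInverse Aᵀ Xᵀ := by
  refine ⟨?_, ?_, ?_, ?_⟩
  · rw [Matrix.mul_assoc, ← Matrix.transpose_mul, ← Matrix.transpose_mul, h.mul_mul_self]
  · rw [Matrix.mul_assoc, ← Matrix.transpose_mul, ← Matrix.transpose_mul, h.mul_mul_inv]
  · rw [← Matrix.transpose_mul, h.symm_right, h.symm_right]
  · rw [← Matrix.transpose_mul, h.symm_left, h.symm_left]

/-- A real symmetric matrix has a pseudo-inverse. -/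
theorem exists_isPseudoInverse_of_isHermitian {n : Type*} [Fintype n] {A : Matrix n n ℝ}
    (hA : A.IsHermitian) : ∃ X : Matrix n n ℝ, IsPseudoInverse A X := by
  classical
  obtain ⟨U, d, hU, hAU⟩ : ∃ (U : Matrix n n ℝ) (d : n → ℝ),
      Uᵀ * U = 1 ∧ A = U * diagonal d * Uᵀ := by
    refine ⟨hA.eigenvectorUnitary, hA.eigenvalues, ?_, ?_⟩
    · have := Unitary.coe_star_mul_self hA.eigenvectorUnitary
      rwa [Matrix.star_eq_conjTranspose, Matrix.conjTranspose_eq_transpose_of_trivial] at this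
    · have := hA.spectral_theorem
      rw [Unitary.conjStarAlgAut_apply, Matrix.star_eq_conjTranspose,
        Matrix.conjTranspose_eq_transpose_of_trivial] at this
      exact this
  have key : ∀ a b : n → ℝ, (U * diagonal a * Uᵀ) * (U * diagonal b * Uᵀ)
      = U * diagonal (fun i => a i * b i) * Uᵀ := by
    intro a b
    calc (U * diagonal a * Uᵀ) * (U * diagonal b * Uᵀ)
        = U * diagonal a * (Uᵀ * U) * diagonal b * Uᵀ := by simp only [Matrix.mul_assoc]
      _ = U * (diagonal a * diagonal b) * Uᵀ := by
          rw [hU, Matrix.mul_one]; simp only [Matrix.mul_assoc]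
      _ = _ := by rw [Matrix.diagonal_mul_diagonal]
  have hs : ∀ a : n → ℝ, (U * diagonal a * Uᵀ)ᵀ = U * diagonal a * Uᵀ := by
    intro a
    simp [Matrix.transpose_mul, Matrix.mul_assoc]
  refine ⟨U * diagonal (fun i => (d i)⁻¹) * Uᵀ, ?_, ?_, ?_, ?_⟩
  · rw [hAU, key, key]
    simp only [mul_inv_mul_cancel]
  · rw [hAU, key, key]
    have e : (fun i => (d i)⁻¹ * d i * (d i)⁻¹) = fun i => (d i)⁻¹ := by
      funext i
      by_cases h : d i = 0 <;> simp [h]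
    rw [e]
  · rw [hAU, key, hs]
  · rw [hAU, key, hs]

/-- Every real matrix has a pseudo-inverse. -/
theorem exists_isPseudoInverse {m n : Type*} [Fintype m] [Fintype n] (A : Matrix m n ℝ) :
    ∃ X : Matrix n m ℝ, IsPseudoInverse A X := by
  have hB : (Aᵀ * A).IsHermitian := by
    rw [Matrix.IsHermitian, Matrix.conjTranspose_eq_transpose_of_trivial,
      Matrix.transpose_mul, Matrix.transpose_transpose]
  obtain ⟨Y, hY⟩ := exists_isPseudoInverse_of_isHermitian hB
  have hYt : IsPseudoInverse (Aᵀ * A) Yᵀ := by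
    have h := hY.transpose
    rwa [Matrix.transpose_mul, Matrix.transpose_transpose] at h
  have hYs : Yᵀ = Y := hYt.unique hY
  have hz : A * (Y * Aᵀ) * A = A := by
    classical
    have h0 : Aᴴ * A * (Y * Aᵀ * A - 1) = 0 := by
      have := hY.mul_mul_self
      rw [Matrix.conjTranspose_eq_transpose_of_trivial, Matrix.mul_sub, Matrix.mul_one,
        Matrix.mul_assoc Y, ← Matrix.mul_assoc, this, sub_self]
    rw [Matrix.conjTranspose_mul_self_mul_eq_zero, Matrix.mul_sub, Matrix.mul_one,
      sub_eq_zero, ← Matrix.mul_assoc] at h0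
    exact h0
  refine ⟨Y * Aᵀ, hz, ?_, ?_, ?_⟩
  · have := hY.mul_mul_inv
    calc Y * Aᵀ * A * (Y * Aᵀ) = (Y * (Aᵀ * A) * Y) * Aᵀ := by simp only [Matrix.mul_assoc]
      _ = Y * Aᵀ := by rw [this]
  · simp only [Matrix.transpose_mul, Matrix.transpose_transpose, hYs, Matrix.mul_assoc]
  · have := hY.symm_right
    rwa [← Matrix.mul_assoc] at this

/-- The Moore–Penrose pseudo-inverse `A⁺`: the unique solution of the Penrose equations. -/
noncomputable def pseudoInverse {m n : Type*} [Fintype m] [Fintype n]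
    (A : Matrix m n ℝ) : Matrix n m ℝ :=
  (exists_isPseudoInverse A).choose

theorem pseudoInverse_spec {m n : Type*} [Fintype m] [Fintype n] (A : Matrix m n ℝ) :
    IsPseudoInverse A (pseudoInverse A) :=
  (exists_isPseudoInverse A).choose_spec

/-! ### Weighted graphs

A weighted graph is a simple graph `G` with a function `w : Sym2 V → ℝ`;
only the values of `w` on the edges of `G` matter. -/

open Classical in
/-- The weighted Laplacian: `-w {i, j}` off the diagonal and `∑ k, w {i, k}` on the diagonal,
where `w {i, j}` is read as `0` if `{i, j}` is not an edge. -/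
noncomputable def laplacian {V : Type*} [Fintype V] (G : SimpleGraph V) (w : Sym2 V → ℝ) :
    Matrix V V ℝ :=
  Matrix.of fun i j =>
    if i = j then ∑ k, (if G.Adj i k then w s(i, k) else 0)
    else -(if G.Adj i j then w s(i, j) else 0)

/-- The Laplacian with the row and the column of `r` removed. -/
noncomputable def reducedLaplacian {V : Type*} [Fintype V] (G : SimpleGraph V)
    (w : Sym2 V → ℝ) (r : V) : Matrix {x : V // x ≠ r} {x : V // x ≠ r} ℝ :=
  (laplacian G w).submatrix Subtype.val Subtype.val

open Classical in
/-- The weight of a graph: the product of the weights of its edges. -/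
noncomputable def graphWeight {V : Type*} [Fintype V] (w : Sym2 V → ℝ) (H : SimpleGraph V) : ℝ :=
  ∏ e ∈ H.edgeFinset, w e

/-- The weight of a set of graphs: the sum of the weights of its members. -/
noncomputable def familyWeight {V : Type*} [Fintype V] (w : Sym2 V → ℝ)
    (S : Finset (SimpleGraph V)) : ℝ :=
  ∑ H ∈ S, graphWeight w H

open Classical in
/-- The spanning trees of `G` (as subgraphs on the whole vertex set). -/
noncomputable def spanningTrees {V : Type*} [Fintype V] (G : SimpleGraph V) :
    Finset (SimpleGraph V) :=
  {T : SimpleGraph V | T ≤ G ∧ T.IsTree}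

open Classical in
/-- The spanning forests of `G` with exactly two trees that do not connect `u` and `v`. -/
noncomputable def separatingForests {V : Type*} [Fintype V] (G : SimpleGraph V) (u v : V) :
    Finset (SimpleGraph V) :=
  {F : SimpleGraph V | F ≤ G ∧ F.IsAcyclic ∧ Nat.card F.ConnectedComponent = 2 ∧
    ¬ F.Reachable u v}

/-- The spanning subgraph formed by the edges of `G` of positive weight; it is `G` itself
when all edge weights are positive. -/
def positivePart {V : Type*} (G : SimpleGraph V) (w : Sym2 V → ℝ) : SimpleGraph V :=
  SimpleGraph.fromEdgeSet {e | e ∈ G.edgeSet ∧ 0 < w e}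

end WeightedGraph

/-! ### Spanning forests with prescribed roots -/

namespace WeightedGraph

/-! For a set `R` of roots, let `M_R` be the Laplacian `L` with the rows and columns of `R` replaced
by those of the identity. The engine is a matrix-tree theorem (`det_maskedLaplacian`): `det M_R` is
the weight of the spanning forests having exactly one element of `R` in each tree. It holds because
both sides obey the same recursion when an edge `ab` with `a ∉ R`, `b ∈ R` is deleted. Since `b` is
masked, the edge only adds `w(ab)` to the entry `(a, a)`, so the determinant splits into the one for
`R` and `w(ab)` times the one for `insert a R`. A forest either avoids `ab`, or loses it and
acquires the additional root `a`.

The roots `{r}` give the spanning trees and `{u, v}` the separating forests. The tree weight is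
positive, so `M_{r}` is invertible, and Cramer's rule gives `w(F) = w(T) * (M_{v}⁻¹) u u`, where `F`
denotes the separating forests and `T` the spanning trees. Column `u` of `M_{v}⁻¹` vanishes at `v`
and solves `L x = e_u - e_v`. As `ker L` consists of the constants, every solution has the same
difference `x u - x v`, whence `w(F) = w(T) * (x u - x v)` (`familyWeight_separatingForests`). Each
formula of the theorem is this identity for one particular solution `x`. -/

/-- In `H ⊔ edge a b`, two vertices are connected either already in `H` or through the edge. -/
theorem reachable_sup_edge {V : Type*} {H : SimpleGraph V} {a b x y : V}
    (h : (H ⊔ SimpleGraph.edge a b).Reachable x y) :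
    H.Reachable x y ∨ (H.Reachable x a ∧ H.Reachable b y) ∨
      (H.Reachable x b ∧ H.Reachable a y) := by
  obtain ⟨p⟩ := h
  induction p with
  | nil => exact Or.inl .rfl
  | @cons x z y hadj p ih =>
    rw [SimpleGraph.sup_adj, SimpleGraph.edge_adj] at hadj
    rcases hadj with hadj | ⟨⟨rfl, rfl⟩ | ⟨rfl, rfl⟩, -⟩
    · have hr : H.Reachable x z := hadj.reachable
      rcases ih with h | ⟨h, h'⟩ | ⟨h, h'⟩
      · exact Or.inl (hr.trans h)
      · exact Or.inr (Or.inl ⟨hr.trans h, h'⟩)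
      · exact Or.inr (Or.inr ⟨hr.trans h, h'⟩)
    · rcases ih with h | ⟨-, h'⟩ | ⟨-, h'⟩
      · exact Or.inr (Or.inl ⟨.rfl, h⟩)
      · exact Or.inr (Or.inl ⟨.rfl, h'⟩)
      · exact Or.inl h'
    · rcases ih with h | ⟨-, h'⟩ | ⟨-, h'⟩
      · exact Or.inr (Or.inr ⟨.rfl, h⟩)
      · exact Or.inl h'
      · exact Or.inr (Or.inr ⟨.rfl, h'⟩)

/-- `F` is a forest in which every tree contains exactly one element of `R`. -/
structure IsRootedForest {V : Type*} (R : Finset V) (F : SimpleGraph V) : Prop where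
  isAcyclic : F.IsAcyclic
  exists_reachable : ∀ x, ∃ r ∈ R, F.Reachable x r
  eq_of_reachable : ∀ r ∈ R, ∀ s ∈ R, F.Reachable r s → r = s

/-- Joining the root `a` to another root `b` by an edge turns forests with roots `insert a R`
into forests with roots `R`. -/
theorem isRootedForest_sup_edge_iff {V : Type*} [DecidableEq V] {R : Finset V}
    {H : SimpleGraph V} {a b : V} (ha : a ∉ R) (hb : b ∈ R) (hab : ¬ H.Adj a b) :
    IsRootedForest R (H ⊔ SimpleGraph.edge a b) ↔ IsRootedForest (insert a R) H := by
  have hne : a ≠ b := fun h => ha (h ▸ hb)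
  have hle : H ≤ H ⊔ SimpleGraph.edge a b := le_sup_left
  have hadj : (H ⊔ SimpleGraph.edge a b).Reachable a b :=
    SimpleGraph.Adj.reachable (by simp [SimpleGraph.edge_adj, hne])
  constructor
  · intro h
    obtain ⟨hacyc, hsep⟩ := SimpleGraph.isAcyclic_sup_fromEdgeSet_iff.1 h.isAcyclic
    have hsep : ¬ H.Reachable a b := fun hr => (hsep hr).elim hne hab
    -- Through the new edge, `b` would reach the root `t`, forcing `t = b`; but `a` and `b` are
    -- separated in `H`.
    have hroot : ∀ t ∈ R, ¬ H.Reachable a t := fun t ht hr => by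
      have := h.eq_of_reachable b hb t ht (hadj.symm.trans (hr.mono hle))
      exact hsep (this ▸ hr)
    refine ⟨hacyc, fun x => ?_, ?_⟩
    · obtain ⟨r, hr, hxr⟩ := h.exists_reachable x
      rcases reachable_sup_edge hxr with h' | ⟨h', -⟩ | ⟨-, h'⟩
      · exact ⟨r, Finset.mem_insert_of_mem hr, h'⟩
      · exact ⟨a, Finset.mem_insert_self _ _, h'⟩
      · exact (hroot r hr h').elim
    · intro r hr s hs hrs
      rcases Finset.mem_insert.1 hr with hra | hr' <;>
        rcases Finset.mem_insert.1 hs with hsa | hs'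
      · rw [hra, hsa]
      · exact (hroot s hs' (hra ▸ hrs)).elim
      · exact (hroot r hr' (hsa ▸ hrs.symm)).elim
      · exact h.eq_of_reachable r hr' s hs' (hrs.mono hle)
  · intro h
    have hroot : ∀ t ∈ R, ¬ H.Reachable a t := fun t ht hr =>
      ha (h.eq_of_reachable a (Finset.mem_insert_self _ _) t (Finset.mem_insert_of_mem ht) hr ▸ ht)
    refine ⟨h.isAcyclic.sup_edge_of_not_reachable (hroot b hb), fun x => ?_, ?_⟩
    · obtain ⟨r, hr, hxr⟩ := h.exists_reachable x
      rcases Finset.mem_insert.1 hr with rfl | hr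
      · exact ⟨b, hb, (hxr.mono hle).trans hadj⟩
      · exact ⟨r, hr, hxr.mono hle⟩
    · intro r hr s hs hrs
      rcases reachable_sup_edge hrs with h' | ⟨h', -⟩ | ⟨-, h'⟩
      · exact h.eq_of_reachable r (Finset.mem_insert_of_mem hr) s (Finset.mem_insert_of_mem hs) h'
      · exact (hroot r hr h'.symm).elim
      · exact (hroot s hs h').elim

theorem graphWeight_sup_edge {V : Type*} [Fintype V] (w : Sym2 V → ℝ) {H : SimpleGraph V}
    {a b : V} (hne : a ≠ b) (hab : ¬ H.Adj a b) :
    graphWeight w (H ⊔ SimpleGraph.edge a b) = w s(a, b) * graphWeight w H := by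
  classical
  unfold graphWeight
  rw [← Finset.prod_insert (by simpa using hab)]
  refine Finset.prod_congr ?_ fun _ _ => rfl
  ext e
  simp [SimpleGraph.edgeSet_edge_of_ne hne, or_comm]

open Classical in
/-- The spanning forests of `G` in which every tree contains exactly one element of `R`. -/
noncomputable def rootedForests {V : Type*} [Fintype V] (G : SimpleGraph V) (R : Finset V) :
    Finset (SimpleGraph V) :=
  {F : SimpleGraph V | F ≤ G ∧ IsRootedForest R F}

theorem mem_rootedForests {V : Type*} [Fintype V] {G F : SimpleGraph V} {R : Finset V} :
    F ∈ rootedForests G R ↔ F ≤ G ∧ IsRootedForest R F := by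
  simp [rootedForests]

theorem familyWeight_rootedForests_sup_edge {V : Type*} [Fintype V] [DecidableEq V]
    (w : Sym2 V → ℝ) {R : Finset V} {H : SimpleGraph V} {a b : V}
    (ha : a ∉ R) (hb : b ∈ R) (hab : ¬ H.Adj a b) :
    familyWeight w (rootedForests (H ⊔ SimpleGraph.edge a b) R) =
      familyWeight w (rootedForests H R) +
        w s(a, b) * familyWeight w (rootedForests H (insert a R)) := by
  classical
  have hne : a ≠ b := fun h => ha (h ▸ hb)
  have hdel : ∀ F : SimpleGraph V, F ≤ H ⊔ SimpleGraph.edge a b → ¬ F.Adj a b → F ≤ H := by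
    intro F hF hn x y hxy
    have := hF hxy
    rw [SimpleGraph.sup_adj, SimpleGraph.edge_adj] at this
    rcases this with h | ⟨⟨rfl, rfl⟩ | ⟨rfl, rfl⟩, -⟩
    · exact h
    · exact (hn hxy).elim
    · exact (hn hxy.symm).elim
  have hrestore : ∀ F : SimpleGraph V, F.Adj a b →
      F.deleteEdges {s(a, b)} ⊔ SimpleGraph.edge a b = F := by
    intro F hF
    ext x y
    simp only [SimpleGraph.sup_adj, SimpleGraph.deleteEdges_adj, SimpleGraph.edge_adj,
      Set.mem_singleton_iff, Sym2.eq_iff]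
    constructor
    · rintro (h | ⟨⟨rfl, rfl⟩ | ⟨rfl, rfl⟩, -⟩)
      exacts [h.1, hF, hF.symm]
    · intro h
      have := h.ne
      tauto
  unfold familyWeight
  rw [← Finset.sum_filter_not_add_sum_filter _ (fun F : SimpleGraph V => F.Adj a b)]
  congr 1
  · refine Finset.sum_congr ?_ fun _ _ => rfl
    ext F
    simp only [Finset.mem_filter, mem_rootedForests]
    constructor
    · rintro ⟨⟨h1, h2⟩, h3⟩
      exact ⟨hdel F h1 h3, h2⟩
    · rintro ⟨h1, h2⟩
      exact ⟨⟨h1.trans le_sup_left, h2⟩, fun h => hab (h1 h)⟩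
  · rw [Finset.mul_sum]
    symm
    refine Finset.sum_nbij' (fun F => F ⊔ SimpleGraph.edge a b)
      (fun F => F.deleteEdges {s(a, b)}) ?_ ?_ ?_ ?_ ?_
    · intro F hF
      rw [mem_rootedForests] at hF
      rw [Finset.mem_filter, mem_rootedForests]
      refine ⟨⟨sup_le_sup_right hF.1 _, ?_⟩, by simp [SimpleGraph.edge_adj, hne]⟩
      exact (isRootedForest_sup_edge_iff ha hb fun h => hab (hF.1 h)).2 hF.2
    · intro F hF
      rw [Finset.mem_filter, mem_rootedForests] at hF
      rw [mem_rootedForests]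
      have hn : ¬ (F.deleteEdges {s(a, b)}).Adj a b := by simp
      refine ⟨hdel _ ((SimpleGraph.deleteEdges_le _).trans hF.1.1) hn, ?_⟩
      rw [← isRootedForest_sup_edge_iff ha hb hn, hrestore F hF.2]
      exact hF.1.2
    · intro F hF
      rw [mem_rootedForests] at hF
      have hn : ¬ F.Adj a b := fun h => hab (hF.1 h)
      ext x y
      simp only [SimpleGraph.sup_adj, SimpleGraph.deleteEdges_adj, SimpleGraph.edge_adj,
        Set.mem_singleton_iff, Sym2.eq_iff]
      constructor
      · tauto
      · intro h
        refine ⟨Or.inl h, ?_⟩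
        rintro (⟨rfl, rfl⟩ | ⟨rfl, rfl⟩)
        exacts [hn h, hn h.symm]
    · intro F hF
      exact hrestore F (Finset.mem_filter.1 hF).2
    · intro F hF
      rw [mem_rootedForests] at hF
      exact (graphWeight_sup_edge w hne fun h => hab (hF.1 h)).symm

/-- If no edge of `G` leaves `R`, then `G` has no spanning forest rooted at `R ≠ univ`. -/
theorem rootedForests_eq_empty {V : Type*} [Fintype V] {G : SimpleGraph V} {R : Finset V}
    (h : ∀ a ∉ R, ∀ b ∈ R, ¬ G.Adj a b) {x : V} (hx : x ∉ R) : rootedForests G R = ∅ := by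
  refine Finset.eq_empty_of_forall_notMem fun F hF => ?_
  rw [mem_rootedForests] at hF
  obtain ⟨r, hr, ⟨p⟩⟩ := hF.2.exists_reachable x
  -- A path from `x ∉ R` to its root must enter `R` somewhere, along an edge that `h` forbids.
  obtain ⟨d, -, hd1, hd2⟩ := p.exists_boundary_dart (R : Set V)ᶜ (by simpa using hx)
    (by simpa using hr)
  exact h d.fst (by simpa using hd1) d.snd (by simpa using hd2) (hF.1 d.adj)

theorem rootedForests_univ {V : Type*} [Fintype V] (G : SimpleGraph V) :
    rootedForests G Finset.univ = {⊥} := by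
  ext F
  rw [mem_rootedForests, Finset.mem_singleton]
  constructor
  · rintro ⟨-, h⟩
    ext x y
    simp only [SimpleGraph.bot_adj, iff_false]
    intro hxy
    exact hxy.ne (h.eq_of_reachable x (Finset.mem_univ _) y (Finset.mem_univ _) hxy.reachable)
  · rintro rfl
    exact ⟨bot_le, SimpleGraph.isAcyclic_bot, fun x => ⟨x, Finset.mem_univ _, .rfl⟩,
      fun r _ s _ h => SimpleGraph.reachable_bot.1 h⟩

theorem rootedForests_singleton {V : Type*} [Fintype V] (G : SimpleGraph V) (r : V) :
    rootedForests G {r} = spanningTrees G := by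
  ext F
  simp only [mem_rootedForests, spanningTrees, Finset.mem_filter, Finset.mem_univ, true_and]
  refine and_congr_right fun _ => ⟨fun h => ?_, fun h => ?_⟩
  · have hr : ∀ x, F.Reachable x r := fun x => by simpa using h.exists_reachable x
    have : Nonempty V := ⟨r⟩
    exact ⟨⟨fun x y => (hr x).trans (hr y).symm⟩, h.isAcyclic⟩
  · exact ⟨h.isAcyclic, fun x => ⟨r, by simp, h.connected.preconnected x r⟩, by simp⟩

theorem rootedForests_pair {V : Type*} [Fintype V] [DecidableEq V] (G : SimpleGraph V) {u v : V}
    (huv : u ≠ v) : rootedForests G {u, v} = separatingForests G u v := by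
  ext F
  simp only [mem_rootedForests, separatingForests, Finset.mem_filter, Finset.mem_univ, true_and]
  refine and_congr_right fun _ => ⟨fun h => ?_, fun ⟨h, hcard, hsep⟩ => ?_⟩
  · have hsep : ¬ F.Reachable u v := fun hr => huv (h.eq_of_reachable u (by simp) v (by simp) hr)
    refine ⟨h.isAcyclic, ?_, hsep⟩
    rw [Nat.card_eq_two_iff]
    refine ⟨F.connectedComponentMk u, F.connectedComponentMk v,
      fun h => hsep (SimpleGraph.ConnectedComponent.eq.1 h), ?_⟩
    refine Set.eq_univ_of_forall fun c => ?_
    induction c using SimpleGraph.ConnectedComponent.ind with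
    | h x =>
      obtain ⟨r, hr, hxr⟩ := h.exists_reachable x
      rw [SimpleGraph.ConnectedComponent.eq.2 hxr]
      rcases Finset.mem_insert.1 hr with rfl | hr
      · simp
      · simp [Finset.mem_singleton.1 hr]
  · refine ⟨h, fun x => ?_, ?_⟩
    · by_contra! hx
      -- A vertex reaching neither `u` nor `v` would create a third component.
      have h3 : ({F.connectedComponentMk u, F.connectedComponentMk v,
          F.connectedComponentMk x} : Set F.ConnectedComponent).ncard = 3 := by
        rw [Set.ncard_eq_three]
        refine ⟨_, _, _, ?_, ?_, ?_, rfl⟩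
        · exact fun h => hsep (SimpleGraph.ConnectedComponent.eq.1 h)
        · exact fun h => hx u (by simp) (SimpleGraph.ConnectedComponent.eq.1 h.symm)
        · exact fun h => hx v (by simp) (SimpleGraph.ConnectedComponent.eq.1 h.symm)
      have := Set.ncard_le_card ({F.connectedComponentMk u, F.connectedComponentMk v,
          F.connectedComponentMk x} : Set F.ConnectedComponent)
      omega
    · intro r hr s hs hrs
      simp only [Finset.mem_insert, Finset.mem_singleton] at hr hs
      rcases hr with rfl | rfl <;> rcases hs with rfl | rfl
      exacts [rfl, (hsep hrs).elim, (hsep hrs.symm).elim, rfl]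

theorem separatingForests_self {V : Type*} [Fintype V] (G : SimpleGraph V) (u : V) :
    separatingForests G u u = ∅ := by
  simp [separatingForests]

/-- Connectedness by edges of positive weight makes the total weight of the spanning trees
positive. -/
theorem familyWeight_spanningTrees_pos {V : Type*} [Fintype V] {G : SimpleGraph V}
    {w : Sym2 V → ℝ} (hw : ∀ e ∈ G.edgeSet, 0 ≤ w e) (hpos : (positivePart G w).Connected) :
    0 < familyWeight w (spanningTrees G) := by
  classical
  obtain ⟨T, hT, hTree⟩ := hpos.exists_isTree_le
  have hedge : ∀ e ∈ T.edgeSet, e ∈ G.edgeSet ∧ 0 < w e := fun e he => by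
    have := SimpleGraph.edgeSet_mono hT he
    rw [positivePart, SimpleGraph.edgeSet_fromEdgeSet] at this
    exact this.1
  refine Finset.sum_pos' (fun F hF => ?_) ⟨T, ?_, ?_⟩
  · simp only [spanningTrees, Finset.mem_filter, Finset.mem_univ, true_and] at hF
    exact Finset.prod_nonneg fun e he =>
      hw e (SimpleGraph.edgeSet_mono hF.1 (SimpleGraph.mem_edgeFinset.1 he))
  · simp only [spanningTrees, Finset.mem_filter, Finset.mem_univ, true_and]
    exact ⟨SimpleGraph.edgeSet_subset_edgeSet.1 fun e he => (hedge e he).1, hTree⟩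
  · exact Finset.prod_pos fun e he => (hedge e (SimpleGraph.mem_edgeFinset.1 he)).2

end WeightedGraph

namespace WeightedGraph

open Matrix

/-! ### Symmetry and kernel of the Laplacian -/

section Laplacian

variable {V : Type*} [Fintype V] (G : SimpleGraph V) (w : Sym2 V → ℝ)

theorem laplacian_transpose : (laplacian G w)ᵀ = laplacian G w := by
  ext i j
  rw [transpose_apply]
  by_cases h : i = j
  · rw [h]
  · simp only [laplacian, of_apply, if_neg h, if_neg (Ne.symm h), Sym2.eq_swap (a := j) (b := i)]
    by_cases hij : G.Adj i j
    · rw [if_pos hij, if_pos hij.symm]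
    · rw [if_neg hij, if_neg fun hji => hij hji.symm]

theorem pseudoInverse_laplacian_comm (i j : V) :
    pseudoInverse (laplacian G w) i j = pseudoInverse (laplacian G w) j i := by
  have h := (pseudoInverse_spec (laplacian G w)).transpose
  rw [laplacian_transpose] at h
  exact congrFun (congrFun (h.unique (pseudoInverse_spec _)) j) i

theorem laplacian_mulVec_const (c : ℝ) : laplacian G w *ᵥ (fun _ => c) = 0 := by
  classical
  ext i
  have h : ∀ j, laplacian G w i j = (if i = j then ∑ k, (if G.Adj i k then w s(i, k) else 0)
      else 0) - (if G.Adj i j then w s(i, j) else 0) := by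
    intro j
    by_cases h : i = j
    · subst h
      simp [laplacian]
    · simp [laplacian, h]
  simp only [mulVec, dotProduct, ← Finset.sum_mul, h, Finset.sum_sub_distrib]
  simp

theorem sum_laplacian_mulVec (x : V → ℝ) : ∑ i, (laplacian G w *ᵥ x) i = 0 := by
  have h : (1 : V → ℝ) ⬝ᵥ laplacian G w *ᵥ x = 0 := by
    rw [dotProduct_mulVec, ← mulVec_transpose, laplacian_transpose]
    have := laplacian_mulVec_const G w 1
    rw [show (1 : V → ℝ) = fun _ => 1 from rfl, this, zero_dotProduct]
  simpa [dotProduct] using h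

theorem laplacian_sup_edge_apply [DecidableEq V] {a b : V} (hne : a ≠ b) (hab : ¬ G.Adj a b)
    {i j : V} (hi : i ≠ b) (hj : j ≠ b) :
    laplacian (G ⊔ SimpleGraph.edge a b) w i j =
      laplacian G w i j + if i = a ∧ j = a then w s(a, b) else 0 := by
  classical
  have hadj : ∀ k, (G ⊔ SimpleGraph.edge a b).Adj i k ↔ G.Adj i k ∨ (i = a ∧ k = b) := by
    intro k
    rw [SimpleGraph.sup_adj, SimpleGraph.edge_adj]
    constructor
    · tauto
    · rintro (h | ⟨rfl, rfl⟩)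
      · exact Or.inl h
      · exact Or.inr ⟨Or.inl ⟨rfl, rfl⟩, hne⟩
  by_cases hij : i = j
  · subst hij
    simp only [laplacian, of_apply, if_true, and_self]
    by_cases hia : i = a
    · subst hia
      rw [if_pos rfl, ← Finset.sum_erase_add _ _ (Finset.mem_univ b),
        ← Finset.sum_erase_add _ (fun k => if G.Adj i k then w s(i, k) else 0)
          (Finset.mem_univ b)]
      rw [if_pos ((hadj b).2 (Or.inr ⟨rfl, rfl⟩)), if_neg hab, add_zero]
      congr 1
      refine Finset.sum_congr rfl fun k hk => ?_
      simp [hadj, Finset.ne_of_mem_erase hk]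
    · simp [hadj, hia]
  · have : ¬ (i = a ∧ j = a) := fun h => hij (h.1.trans h.2.symm)
    simp only [laplacian, of_apply, if_neg hij, if_neg this, hadj, hj, and_false, or_false,
      add_zero]

/-! ### Masked Laplacians and the matrix-tree theorem -/

variable [DecidableEq V]

/-- The Laplacian with the rows and columns of the vertices in `R` replaced by those of the
identity matrix. -/
noncomputable def maskedLaplacian (R : Finset V) : Matrix V V ℝ :=
  Matrix.of fun i j => if i ∈ R ∨ j ∈ R then (1 : Matrix V V ℝ) i j else laplacian G w i j

/-- The edge `ab` alters four entries of the Laplacian, but three lie in the row or column of the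
masked vertex `b`. The surviving change at `(a, a)` is written as a row update so that
multilinearity of `det` applies. -/
theorem maskedLaplacian_sup_edge {R : Finset V} {a b : V} (ha : a ∉ R) (hb : b ∈ R)
    (hab : ¬ G.Adj a b) :
    maskedLaplacian (G ⊔ SimpleGraph.edge a b) w R =
      (maskedLaplacian G w R).updateRow a
        (maskedLaplacian G w R a + w s(a, b) • Pi.single a 1) := by
  have hne : a ≠ b := fun h => ha (h ▸ hb)
  ext i j
  by_cases hR : i ∈ R ∨ j ∈ R
  · by_cases hia : i = a
    · subst hia
      have hj : j ∈ R := hR.resolve_left ha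
      have hij : j ≠ i := fun h => ha (h ▸ hj)
      simp [maskedLaplacian, hj, hij]
    · simp [maskedLaplacian, hR, updateRow_ne hia]
  · have hi : i ≠ b := fun h => hR (Or.inl (h ▸ hb))
    have hj : j ≠ b := fun h => hR (Or.inr (h ▸ hb))
    by_cases hia : i = a
    · subst hia
      rw [maskedLaplacian, of_apply, if_neg hR, laplacian_sup_edge_apply G w hne hab hi hj]
      simp [maskedLaplacian, hR, Pi.single_apply]
    · simp [maskedLaplacian, hR, hia,
        laplacian_sup_edge_apply G w hne hab hi hj]

/-- The cofactor at `(a, a)` is the determinant after row `a` becomes `e_a`. Replacing column `a` by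
`e_a` as well does not change it, and that matrix is the mask for `insert a R`. -/
theorem adjugate_maskedLaplacian_self {R : Finset V} (a : V) :
    (maskedLaplacian G w R).adjugate a a = (maskedLaplacian G w (insert a R)).det := by
  set A := (maskedLaplacian G w R).updateRow a (Pi.single a 1) with hA
  have hcol : (maskedLaplacian G w (insert a R))ᵀ = Aᵀ.updateRow a (Pi.single a 1) := by
    ext i j
    by_cases hi : i = a
    · subst hi
      simp [maskedLaplacian, one_apply, Pi.single_apply]
    · rw [updateRow_ne hi, transpose_apply, transpose_apply, hA]
      by_cases hj : j = a
      · subst hj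
        simp [maskedLaplacian, one_apply, hi, Ne.symm hi]
      · simp [maskedLaplacian, hi, hj]
  rw [← det_transpose (maskedLaplacian G w (insert a R)), hcol, ← adjugate_apply,
    ← adjugate_transpose, transpose_apply, adjugate_apply, adjugate_apply, hA, updateRow_idem]

theorem det_maskedLaplacian_sup_edge {R : Finset V} {a b : V} (ha : a ∉ R) (hb : b ∈ R)
    (hab : ¬ G.Adj a b) :
    (maskedLaplacian (G ⊔ SimpleGraph.edge a b) w R).det =
      (maskedLaplacian G w R).det + w s(a, b) * (maskedLaplacian G w (insert a R)).det := by
  rw [maskedLaplacian_sup_edge G w ha hb hab, det_updateRow_add, det_updateRow_smul,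
    updateRow_eq_self, ← adjugate_apply, adjugate_maskedLaplacian_self]

theorem det_maskedLaplacian_eq_zero {R : Finset V} (h : ∀ a ∉ R, ∀ b ∈ R, ¬ G.Adj a b) {x : V}
    (hx : x ∉ R) : (maskedLaplacian G w R).det = 0 := by
  rw [← exists_mulVec_eq_zero_iff]
  -- With no edge between `R` and its complement, the indicator of the complement is a kernel
  -- vector: on unmasked rows it acts like the constant `1`.
  refine ⟨fun i => if i ∈ R then 0 else 1, fun h0 => ?_, ?_⟩
  · simpa [hx] using congrFun h0 x
  · ext i
    by_cases hi : i ∈ R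
    · refine Finset.sum_eq_zero fun j _ => ?_
      by_cases hj : j ∈ R
      · simp [hj]
      · have : i ≠ j := fun h => hj (h ▸ hi)
        simp [maskedLaplacian, hi, this]
    · have h1 := congrFun (laplacian_mulVec_const G w 1) i
      rw [← h1]
      refine Finset.sum_congr rfl fun j _ => ?_
      by_cases hj : j ∈ R
      · have : i ≠ j := fun h => hi (h ▸ hj)
        simp [laplacian, hj, this, h i hi j hj]
      · simp [maskedLaplacian, hi, hj]

/-- The matrix-tree theorem for forests with prescribed roots. -/
theorem det_maskedLaplacian (R : Finset V) :
    (maskedLaplacian G w R).det = familyWeight w (rootedForests G R) := by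
  -- `R` must vary, since deleting an edge enlarges the root set in one of the two terms.
  induction G using WellFoundedLT.induction generalizing R with
  | _ G ih =>
    by_cases hcut : ∃ a ∉ R, ∃ b ∈ R, G.Adj a b
    · obtain ⟨a, ha, b, hb, hab⟩ := hcut
      set H := G.deleteEdges {s(a, b)} with hH
      have hn : ¬ H.Adj a b := by simp [hH]
      have hG : H ⊔ SimpleGraph.edge a b = G := by
        ext x y
        simp only [hH, SimpleGraph.sup_adj, SimpleGraph.deleteEdges_adj, SimpleGraph.edge_adj,
          Set.mem_singleton_iff, Sym2.eq_iff]
        constructor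
        · rintro (h | ⟨⟨rfl, rfl⟩ | ⟨rfl, rfl⟩, -⟩)
          exacts [h.1, hab, hab.symm]
        · intro h
          have := h.ne
          tauto
      have hlt : H < G :=
        lt_of_le_of_ne (SimpleGraph.deleteEdges_le _) fun h => hn (h ▸ hab)
      rw [← hG, det_maskedLaplacian_sup_edge H w ha hb hn,
        familyWeight_rootedForests_sup_edge w ha hb hn, ih H hlt, ih H hlt]
    · push Not at hcut
      by_cases hR : R = Finset.univ
      · subst hR
        have : maskedLaplacian G w Finset.univ = 1 := by
          ext i j
          simp [maskedLaplacian]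
        rw [this, rootedForests_univ]
        rw [familyWeight, Finset.sum_singleton, graphWeight, det_one]
        exact (Finset.prod_eq_one fun e he => by simp at he).symm
      · obtain ⟨x, hx⟩ : ∃ x, x ∉ R := by
          by_contra! h
          exact hR (Finset.eq_univ_iff_forall.2 h)
        rw [det_maskedLaplacian_eq_zero G w hcut hx, rootedForests_eq_empty hcut hx]
        simp [familyWeight]

/-! ### Potentials of unit currents -/

variable {G w}

theorem det_maskedLaplacian_singleton (r : V) :
    (maskedLaplacian G w {r}).det = familyWeight w (spanningTrees G) := by
  rw [det_maskedLaplacian, rootedForests_singleton]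

theorem isUnit_det_maskedLaplacian_singleton (hT : familyWeight w (spanningTrees G) ≠ 0) (r : V) :
    IsUnit (maskedLaplacian G w {r}).det := by
  rw [det_maskedLaplacian_singleton]
  exact hT.isUnit

theorem maskedLaplacian_mulVec_apply_self (r : V) (x : V → ℝ) :
    (maskedLaplacian G w {r} *ᵥ x) r = x r := by
  simp [mulVec, dotProduct, maskedLaplacian, one_apply]

/-- Row `i` is altered by the mask only in column `r`, where `x` vanishes. -/
theorem maskedLaplacian_mulVec_apply_of_ne {r i : V} (hi : i ≠ r) {x : V → ℝ} (hx : x r = 0) :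
    (maskedLaplacian G w {r} *ᵥ x) i = (laplacian G w *ᵥ x) i := by
  refine Finset.sum_congr rfl fun j _ => ?_
  by_cases hj : j = r
  · rw [hj, hx, mul_zero, mul_zero]
  · simp [maskedLaplacian, hi, hj]

theorem maskedLaplacian_mulVec_inv_col (hT : familyWeight w (spanningTrees G) ≠ 0) (r u : V) :
    maskedLaplacian G w {r} *ᵥ ((maskedLaplacian G w {r})⁻¹.col u) = Pi.single u 1 := by
  rw [← mulVec_single_one, mulVec_mulVec,
    mul_nonsing_inv _ (isUnit_det_maskedLaplacian_singleton hT r), one_mulVec]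

theorem inv_maskedLaplacian_apply_eq_zero (hT : familyWeight w (spanningTrees G) ≠ 0) {r u : V}
    (hu : u ≠ r) : (maskedLaplacian G w {r})⁻¹ r u = 0 := by
  have h := maskedLaplacian_mulVec_apply_self (G := G) (w := w) r
    ((maskedLaplacian G w {r})⁻¹.col u)
  rw [maskedLaplacian_mulVec_inv_col hT, Pi.single_eq_of_ne hu.symm] at h
  exact h.symm

/-- The columns of the inverse of the masked Laplacian are potentials of unit currents. -/
theorem laplacian_mulVec_inv_col (hT : familyWeight w (spanningTrees G) ≠ 0) {r u : V}
    (hu : u ≠ r) : laplacian G w *ᵥ ((maskedLaplacian G w {r})⁻¹.col u) =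
      Pi.single u 1 - Pi.single r 1 := by
  have hne : ∀ i, i ≠ r → (laplacian G w *ᵥ ((maskedLaplacian G w {r})⁻¹.col u)) i =
      (Pi.single u 1 - Pi.single r 1 : V → ℝ) i := by
    intro i hi
    have h0 : (maskedLaplacian G w {r})⁻¹.col u r = 0 := inv_maskedLaplacian_apply_eq_zero hT hu
    rw [← maskedLaplacian_mulVec_apply_of_ne hi h0,
      maskedLaplacian_mulVec_inv_col hT]
    simp [hi]
  ext i
  by_cases hi : i = r
  · subst hi
    -- Both sides have coordinate sum zero and agree away from the root, hence they agree at the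
    -- root too.
    have h1 := sum_laplacian_mulVec G w ((maskedLaplacian G w {i})⁻¹.col u)
    have h2 : ∑ j, (Pi.single u 1 - Pi.single i 1 : V → ℝ) j = 0 := by simp
    rw [← Finset.add_sum_erase _ _ (Finset.mem_univ i)] at h1 h2
    rw [Finset.sum_congr rfl fun j hj => hne j (Finset.ne_of_mem_erase hj)] at h1
    linarith
  · exact hne i hi

theorem reducedLaplacian_mul_submatrix_inv (hT : familyWeight w (spanningTrees G) ≠ 0) (r : V) :
    reducedLaplacian G w r *
      ((maskedLaplacian G w {r})⁻¹.submatrix Subtype.val Subtype.val) = 1 := by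
  ext i j
  have h := congrFun (laplacian_mulVec_inv_col hT j.2) i.1
  rw [mulVec, dotProduct, Fintype.sum_eq_add_sum_subtype_ne _ r, col_apply,
    inv_maskedLaplacian_apply_eq_zero hT j.2, mul_zero, zero_add] at h
  refine h.trans ?_
  simp [i.2, one_apply, Pi.single_apply, Subtype.ext_iff]

theorem isUnit_reducedLaplacian (hT : familyWeight w (spanningTrees G) ≠ 0) (r : V) :
    IsUnit (reducedLaplacian G w r) :=
  IsUnit.of_mul_eq_one _ (reducedLaplacian_mul_submatrix_inv hT r)

theorem inv_reducedLaplacian_apply (hT : familyWeight w (spanningTrees G) ≠ 0) {r : V}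
    (i j : {x : V // x ≠ r}) :
    (reducedLaplacian G w r)⁻¹ i j = (maskedLaplacian G w {r})⁻¹ i j := by
  rw [inv_eq_right_inv (reducedLaplacian_mul_submatrix_inv hT r), submatrix_apply]

theorem inv_maskedLaplacian_comm (R : Finset V) (i j : V) :
    (maskedLaplacian G w R)⁻¹ i j = (maskedLaplacian G w R)⁻¹ j i := by
  have h : (maskedLaplacian G w R)ᵀ = maskedLaplacian G w R := by
    ext i j
    have := congrFun (congrFun (laplacian_transpose G w) i) j
    rw [transpose_apply] at this
    simp [maskedLaplacian, this, one_apply, or_comm, eq_comm]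
  conv_rhs => rw [← h, ← transpose_nonsing_inv, transpose_apply]

/-- Potential differences are determined by the current. -/
theorem sub_eq_sub_of_laplacian_mulVec_eq (hT : familyWeight w (spanningTrees G) ≠ 0)
    {x y : V → ℝ} (h : laplacian G w *ᵥ x = laplacian G w *ᵥ y) (u v : V) :
    x u - x v = y u - y v := by
  -- Shifting by a constant grounds the difference at `v`, so that the invertible mask at `v`
  -- annihilates it.
  set z : V → ℝ := x - y - fun _ => x v - y v with hz
  have hzv : z v = 0 := by simp [hz]
  have hLz : laplacian G w *ᵥ z = 0 := by
    rw [hz, mulVec_sub, mulVec_sub, h, laplacian_mulVec_const, sub_self, sub_zero]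
  have hMz : maskedLaplacian G w {v} *ᵥ z = 0 := by
    ext i
    by_cases hi : i = v
    · rw [hi, maskedLaplacian_mulVec_apply_self, hzv, Pi.zero_apply]
    · rw [maskedLaplacian_mulVec_apply_of_ne hi hzv, hLz]
  have hz0 := eq_zero_of_mulVec_eq_zero (isUnit_det_maskedLaplacian_singleton hT v).ne_zero hMz
  have := congrFun hz0 u
  simp only [hz, Pi.sub_apply, Pi.zero_apply] at this
  linarith

/-- The weight of the forests separating `u` from `v` is the weight of the spanning trees times
the potential difference of a unit current from `u` to `v`. -/
theorem familyWeight_separatingForests (hT : familyWeight w (spanningTrees G) ≠ 0) {u v : V}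
    {x : V → ℝ} (hx : laplacian G w *ᵥ x = Pi.single u 1 - Pi.single v 1) :
    familyWeight w (separatingForests G u v) =
      familyWeight w (spanningTrees G) * (x u - x v) := by
  by_cases huv : u = v
  · subst huv
    simp [separatingForests_self, familyWeight]
  · have hdiff := sub_eq_sub_of_laplacian_mulVec_eq hT
      (hx.trans (laplacian_mulVec_inv_col hT huv).symm) u v
    -- Cramer's rule: the `(u, u)` entry of the inverse is the determinant for roots `{u, v}`
    -- divided by the one for `{v}`.
    rw [col_apply, col_apply, inv_maskedLaplacian_apply_eq_zero hT huv, sub_zero, inv_def,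
      Matrix.smul_apply, smul_eq_mul, Ring.inverse_eq_inv', det_maskedLaplacian_singleton,
      adjugate_maskedLaplacian_self, det_maskedLaplacian, rootedForests_pair G huv] at hdiff
    rw [hdiff, mul_inv_cancel_left₀ hT]

/-- `L * L⁺` fixes the range of `L`, and `e_u - e_v` lies in that range by
`laplacian_mulVec_inv_col`. -/
theorem laplacian_mulVec_pseudoInverse_mulVec (hT : familyWeight w (spanningTrees G) ≠ 0)
    (u v : V) : laplacian G w *ᵥ (pseudoInverse (laplacian G w) *ᵥ
      (Pi.single u 1 - Pi.single v 1)) = Pi.single u 1 - Pi.single v 1 := by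
  by_cases huv : u = v
  · simp [huv]
  · rw [← laplacian_mulVec_inv_col hT huv, mulVec_mulVec, mulVec_mulVec,
      (pseudoInverse_spec (laplacian G w)).mul_mul_self]

end Laplacian

end WeightedGraph

open WeightedGraph in
theorem lemma2p2 {V : Type*} [Fintype V] [DecidableEq V] (G : SimpleGraph V)
    (w : Sym2 V → ℝ) (hw : ∀ e ∈ G.edgeSet, 0 ≤ w e)
    (hG : G.Connected) (hpos : (positivePart G w).Connected) (u v : V) :
    familyWeight w (separatingForests G u v) =
        familyWeight w (spanningTrees G) *
          (pseudoInverse (laplacian G w) u u + pseudoInverse (laplacian G w) v v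
            - 2 * pseudoInverse (laplacian G w) u v) ∧
    (∀ r : V, IsUnit (reducedLaplacian G w r)) ∧
    (∀ (r : V) (hu : u ≠ r) (hv : v ≠ r),
      familyWeight w (separatingForests G u v) =
        familyWeight w (spanningTrees G) *
          ((reducedLaplacian G w r)⁻¹ ⟨u, hu⟩ ⟨u, hu⟩
            + (reducedLaplacian G w r)⁻¹ ⟨v, hv⟩ ⟨v, hv⟩
            - 2 * (reducedLaplacian G w r)⁻¹ ⟨u, hu⟩ ⟨v, hv⟩)) ∧
    (∀ huv : u ≠ v,
      familyWeight w (separatingForests G u v) =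
        familyWeight w (spanningTrees G) *
          (reducedLaplacian G w v)⁻¹ ⟨u, huv⟩ ⟨u, huv⟩) ∧
    (∀ huv : u ≠ v,
      familyWeight w (separatingForests G u v) =
        familyWeight w (spanningTrees G) *
          (reducedLaplacian G w u)⁻¹ ⟨v, huv.symm⟩ ⟨v, huv.symm⟩) := by
  have hT : familyWeight w (spanningTrees G) ≠ 0 := (familyWeight_spanningTrees_pos hw hpos).ne'
  refine ⟨?_, isUnit_reducedLaplacian hT, fun r hu hv => ?_, fun huv => ?_, fun huv => ?_⟩
  · rw [familyWeight_separatingForests hT (laplacian_mulVec_pseudoInverse_mulVec hT u v),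
      Matrix.mulVec_sub, Matrix.mulVec_single_one, Matrix.mulVec_single_one]
    simp only [Pi.sub_apply, Matrix.col_apply, pseudoInverse_laplacian_comm G w v u]
    ring
  -- Superposition: a current from `u` to `r` minus one from `v` to `r` is a current from `u` to
  -- `v`.
  · rw [familyWeight_separatingForests hT
      (x := (maskedLaplacian G w {r})⁻¹.col u - (maskedLaplacian G w {r})⁻¹.col v)
      (by rw [Matrix.mulVec_sub, laplacian_mulVec_inv_col hT hu, laplacian_mulVec_inv_col hT hv,
        sub_sub_sub_cancel_right])]
    simp only [inv_reducedLaplacian_apply hT, Pi.sub_apply, Matrix.col_apply,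
      inv_maskedLaplacian_comm {r} v u]
    ring
  · rw [familyWeight_separatingForests hT (laplacian_mulVec_inv_col hT huv),
      inv_reducedLaplacian_apply hT, Matrix.col_apply, Matrix.col_apply,
      inv_maskedLaplacian_apply_eq_zero hT huv, sub_zero]
  -- The current from `v` to the grounded vertex `u` is reversed, hence the sign.
  · rw [familyWeight_separatingForests hT (x := -(maskedLaplacian G w {u})⁻¹.col v)
      (by rw [Matrix.mulVec_neg, laplacian_mulVec_inv_col hT huv.symm, neg_sub]),
      inv_reducedLaplacian_apply hT, Pi.neg_apply, Pi.neg_apply, Matrix.col_apply,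
      Matrix.col_apply, inv_maskedLaplacian_apply_eq_zero hT huv.symm, neg_zero, zero_sub, neg_neg]
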